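/- Conventions. Let $P$ be a nonempty set of propositional letters, $p\in P$. Formulas are built from letters of $P$ by $\top,\bot,\wedge,\vee,\Box,\Diamond$; a consequence pair is an expression $\phi\trianglelefteq\psi$ with $\phi,\psi$ formulas. For a set $\Delta$ of consequence pairs, $\mathcal L(\Delta)$ is the smallest set of consequence pairs that contains $\Delta$, is closed under uniform substitution, and is closed under the following axioms and rules (for all formulas $\alpha,\beta,\gamma$): $\alpha\trianglelefteq\top$; $\bot\trianglelefteq \alpha$; $\alpha\trianglelefteq \alpha$; from $\alpha\trianglelefteq \beta$ and $\beta\trianglelefteq \gamma$ infer $\alpha\trianglelefteq \gamma$; $\alpha\wedge \beta\trianglelefteq \alpha$; $\alpha\wedge \beta\trianglelefteq \beta$; $\alpha\trianglelefteq \alpha\vee \beta$; $\beta\trianglelefteq \alpha\vee \beta$; from $\alpha\trianglelefteq \beta$ and $\alpha\trianglelefteq \gamma$ infer $\alpha\trianglelefteq \beta\wedge \gamma$; from $\alpha\trianglelefteq \gamma$ and $\beta\trianglelefteq \gamma$ infer $\alpha\vee \beta\trianglelefteq \gamma$; $\top\trianglelefteq\Box\top$; $\top\trianglelefteq\Diamond\top$;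 from $\alpha\trianglelefteq \beta$ infer $\Box \alpha\trianglelefteq\Box \beta$ and $\Diamond \alpha\trianglelefteq\Diamond \beta$; $\Box \alpha\wedge\Box \beta\trianglelefteq\Box(\alpha\wedge \beta)$; $\Diamond \alpha\wedge\Box \beta\trianglelefteq\Diamond(\alpha\wedge \beta)$. A modal lattice is a bounded lattice $A$ with operations $\Box,\Diamond$ satisfying $\Box\top=\top$, $\Diamond\top=\top$, $\Box a\wedge\Box b=\Box(a\wedge b)$, $\Diamond a\vee\Diamond b\le\Diamond(a\vee b)$, $\Diamond a\wedge\Box b\le\Diamond(a\wedge b)$. $\mathsf K(\Delta)$ is the class of modal lattices $A$ such that $\sigma(\phi)\le\sigma(\psi)$ for every $\phi\trianglelefteq\psi$ in $\Delta$ and every homomorphism $\sigma$ from formulas to $A$. An L-frame is a meet semilattice $(X,1,\curlywedge)$ with top element $1$ and order $\preceq$. Filters are nonempty up-sets closed under binary meets (the improper filter is allowed). A modal L-frame is an L-frame with a binary relation $R$ such that: (i) if $x\preceq y$ and $yRz$, there is $w$ with $xRw$ and $w\preceq z$; (ii) if $x\preceq y$ and $xRw$, there is $z$ with $yRz$ and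 $w\preceq z$; (iii) if $(x\curlywedge y)Rz$, there are $u,v$ with $xRu$, $yRv$ and $u\curlywedge v\preceq z$; (iv) if $xRu$ and $yRv$ then $(x\curlywedge y)R(u\curlywedge v)$; (v) $1Rx$ iff $x=1$. A valuation $V$ assigns a filter $V(q)$ of $X$ to each letter $q$, and truth at $x\in X$ is defined by: $x\Vdash q$ iff $x\in V(q)$; $x\Vdash\top$ always; $x\Vdash\bot$ iff $x=1$; $x\Vdash\phi\wedge\psi$ iff $x\Vdash\phi$ and $x\Vdash\psi$; $x\Vdash\phi\vee\psi$ iff there are $y\Vdash\phi$ and $z\Vdash\psi$ with $y\curlywedge z\preceq x$; $x\Vdash\Box\phi$ iff $y\Vdash\phi$ for all $y$ with $xRy$; $x\Vdash\Diamond\phi$ iff $y\Vdash\phi$ for some $y$ with $xRy$. The frame validates $\phi\trianglelefteq\psi$ if, under every valuation, $\psi$ is true at every point at which $\phi$ is true. $\mathcal L(\Delta)$ is sound and complete with respect to a class $\mathsf C$ of modal L-frames if for all formulas $\phi,\psi$ over $P$: $\phi\trianglelefteq\psi$ is validated by all members of $\mathsf C$ iff it belongs to $\mathcal L(\Delta)$.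 An L-space is an L-frame with a compact topology such that whenever $x\not\preceq y$ some clopen filter contains $x$ but not $y$, such that $\{1\}$ is clopen, and such that for clopen filters $U,V$ the filter $\{x\mid \exists y\in U,\ z\in V:\ y\curlywedge z\preceq x\}$ is clopen. For a relation $R$ put $R[x]=\{y\mid xRy\}$, $\Box_RU=\{x\mid R[x]\subseteq U\}$ and $\Diamond_RU=\{x\mid R[x]\cap U\ne\emptyset\}$. A modal L-space is an L-space with a binary relation $R$ such that every $R[x]$ is nonempty; $1Rx$ iff $x=1$; $\Box_RU$ and $\Diamond_RU$ are clopen filters whenever $U$ is; and $xRy$ iff for all clopen filters $U$, $x\in\Box_RU$ implies $y\in U$ and $y\in U$ implies $x\in\Diamond_RU$. A morphism of modal L-spaces is a continuous map $f$ that preserves $1$, $\curlywedge$ and $R$ and satisfies: $f(x)=1$ implies $x=1$; if $y'\curlywedge z'\preceq f(x)$, there are $y,z$ with $y'\preceq f(y)$, $z'\preceq f(z)$ and $y\curlywedge z\preceq x$; if $f(x)Rz$, there are $y,y'$ with $xRy$, $xRy'$ and $f(y)\preceq z\preceq f(y')$. Isomorphisms are mutually inverse pairs of such morphisms. The dual $\mathsf{Fil_L}(A)$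 of a modal lattice $A$ is the set of filters of $A$ (including $A$), ordered by inclusion, with meet given by intersection and top element $A$, with the topology generated by the sets $\{F\mid a\in F\}$ $(a\in A)$ and their complements, and with the relation $F R G$ iff for all $a\in A$, $\Box a\in F$ implies $a\in G$ and $a\in G$ implies $\Diamond a\in F$. Consider the axioms $\mathsf T$: $\Box p\trianglelefteq p$, $p\trianglelefteq\Diamond p$; $\mathsf 4$: $\Box p\trianglelefteq\Box\Box p$, $\Diamond\Diamond p\trianglelefteq\Diamond p$; $\mathsf B$: $p\trianglelefteq\Box\Diamond p$, $\Diamond\Box p\trianglelefteq p$; $\mathsf 5$: $\Diamond p\trianglelefteq\Box\Diamond p$, $\Diamond\Box p\trianglelefteq\Box p$; $\mathsf{.2}$: $\Diamond\Box p\trianglelefteq\Box\Diamond p$. To them correspond, respectively, reflexivity ($xRx$), transitivity ($xRy$, $yRz$ imply $xRz$), symmetry ($xRy$ implies $yRx$), Euclideanity ($xRy$, $xRz$ imply $yRz$) and directedness ($xRy$, $xRz$ imply that there is $t$ with $yRt$ and $zRt$). Theorem. Let $\Gamma\subseteq\{\mathsf T,\mathsf 4,\mathsf B,\mathsf 5,\mathsf{.2}\}$,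 and let $\Theta_\Gamma$ be the set of relational properties corresponding to the axioms in $\Gamma$. (1) The class of modal L-spaces satisfying $\Theta_\Gamma$ is exactly, up to isomorphism of modal L-spaces, the class of the duals $\mathsf{Fil_L}(A)$ with $A\in\mathsf K(\Gamma)$: a semilattice with top, topology and binary relation is a modal L-space satisfying $\Theta_\Gamma$ if and only if it is isomorphic to $\mathsf{Fil_L}(A)$ for some $A\in\mathsf K(\Gamma)$. (2) The logic $\mathcal L(\Gamma)$ is sound and complete with respect to the class of modal L-frames satisfying $\Theta_\Gamma$. -/

import Mathlib

universe u v w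

namespace WPML

/-! ### Syntax and proof theory -/

/-- Formulas of the language of modal lattices over the propositional letters `P`. -/
inductive Form (P : Type u) : Type u
  | var : P → Form P
  | top : Form P
  | bot : Form P
  | and : Form P → Form P → Form P
  | or : Form P → Form P → Form P
  | box : Form P → Form P
  | dia : Form P → Form P

/-- Uniform substitution. -/
def Form.subst {P : Type u} (σ : P → Form P) : Form P → Form P
  | .var p => σ p
  | .top => .top
  | .bot => .bot
  | .and φ ψ => .and (φ.subst σ) (ψ.subst σ)
  | .or φ ψ => .or (φ.subst σ) (ψ.subst σ)
  | .box φ => .box (φ.subst σ)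
  | .dia φ => .dia (φ.subst σ)

/-- A consequence pair `lhs ⊴ rhs`. -/
structure ConsequencePair (P : Type u) : Type u where
  lhs : Form P
  rhs : Form P

/-- `Derives Γ φ ψ` says that `φ ⊴ ψ` belongs to the logic `L(Γ)`: the least set of consequence
pairs that contains `Γ` and is closed under uniform substitution and under the axioms and rules of
weak positive modal logic. -/
inductive Derives {P : Type u} (Γ : Set (ConsequencePair P)) : Form P → Form P → Prop
  | ax {c : ConsequencePair P} : c ∈ Γ → Derives Γ c.lhs c.rhs
  | subst (σ : P → Form P) {φ ψ : Form P} :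
      Derives Γ φ ψ → Derives Γ (φ.subst σ) (ψ.subst σ)
  | top (φ : Form P) : Derives Γ φ .top
  | bot (φ : Form P) : Derives Γ .bot φ
  | refl (φ : Form P) : Derives Γ φ φ
  | trans {φ ψ χ : Form P} : Derives Γ φ ψ → Derives Γ ψ χ → Derives Γ φ χ
  | and_left (φ ψ : Form P) : Derives Γ (.and φ ψ) φ
  | and_right (φ ψ : Form P) : Derives Γ (.and φ ψ) ψ
  | or_left (φ ψ : Form P) : Derives Γ φ (.or φ ψ)
  | or_right (φ ψ : Form P) : Derives Γ ψ (.or φ ψ)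
  | and_intro {φ ψ χ : Form P} : Derives Γ φ ψ → Derives Γ φ χ → Derives Γ φ (.and ψ χ)
  | or_elim {φ ψ χ : Form P} : Derives Γ φ χ → Derives Γ ψ χ → Derives Γ (.or φ ψ) χ
  | box_top : Derives Γ .top (.box .top)
  | dia_top : Derives Γ .top (.dia .top)
  | box_mono {φ ψ : Form P} : Derives Γ φ ψ → Derives Γ (.box φ) (.box ψ)
  | dia_mono {φ ψ : Form P} : Derives Γ φ ψ → Derives Γ (.dia φ) (.dia ψ)
  | linearity (φ ψ : Form P) : Derives Γ (.and (.box φ) (.box ψ)) (.box (.and φ ψ))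
  | duality (φ ψ : Form P) : Derives Γ (.and (.dia φ) (.box ψ)) (.dia (.and φ ψ))

/-! ### Algebraic semantics -/

/-- Modal lattices. -/
class ModalLattice (A : Type w) extends Lattice A, BoundedOrder A where
  box : A → A
  dia : A → A
  box_top : box ⊤ = ⊤
  dia_top : dia ⊤ = ⊤
  box_inf_box : ∀ a b : A, box a ⊓ box b = box (a ⊓ b)
  dia_sup_dia_le : ∀ a b : A, dia a ⊔ dia b ≤ dia (a ⊔ b)
  dia_inf_box_le : ∀ a b : A, dia a ⊓ box b ≤ dia (a ⊓ b)

/-- The homomorphism from the formula algebra to `A` that extends `σ : P → A`. -/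
def Form.eval {P : Type u} {A : Type w} [ModalLattice A] (σ : P → A) : Form P → A
  | .var p => σ p
  | .top => ⊤
  | .bot => ⊥
  | .and φ ψ => φ.eval σ ⊓ ψ.eval σ
  | .or φ ψ => φ.eval σ ⊔ ψ.eval σ
  | .box φ => ModalLattice.box (φ.eval σ)
  | .dia φ => ModalLattice.dia (φ.eval σ)

/-- `A` belongs to the variety `K(Γ)`: it validates every consequence pair in `Γ`. -/
def InVariety {P : Type u} (Γ : Set (ConsequencePair P)) (A : Type w) [ModalLattice A] : Prop :=
  ∀ c ∈ Γ, ∀ σ : P → A, c.lhs.eval σ ≤ c.rhs.eval σ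

/-! ### Modal L-frames -/

/-- The conditions on a relation `R` that turn an L-frame, that is, a meet semilattice with a top
element `1 = ⊤`, into a modal L-frame. -/
structure IsModalLFrame {X : Type v} [SemilatticeInf X] [OrderTop X] (R : X → X → Prop) :
    Prop where
  back_le : ∀ x y z, x ≤ y → R y z → ∃ w, R x w ∧ w ≤ z
  forth_le : ∀ x y w, x ≤ y → R x w → ∃ z, R y z ∧ w ≤ z
  of_inf : ∀ x y z, R (x ⊓ y) z → ∃ u v, R x u ∧ R y v ∧ u ⊓ v ≤ z
  inf : ∀ x y u v, R x u → R y v → R (x ⊓ y) (u ⊓ v)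
  top_iff : ∀ x, R ⊤ x ↔ x = ⊤

/-- Modal L-frames. -/
structure ModalLFrame : Type (v + 1) where
  carrier : Type v
  [semilatticeInf : SemilatticeInf carrier]
  [orderTop : OrderTop carrier]
  rel : carrier → carrier → Prop
  isModalLFrame : IsModalLFrame rel

attribute [instance] ModalLFrame.semilatticeInf ModalLFrame.orderTop

/-- Truth at the state `x` of the model with relation `R` and valuation `V`. -/
def Forces {P : Type u} {X : Type v} [SemilatticeInf X] [OrderTop X] (R : X → X → Prop)
    (V : P → Order.PFilter X) : X → Form P → Prop
  | x, .var p => x ∈ V p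
  | _, .top => True
  | x, .bot => x = ⊤
  | x, .and φ ψ => Forces R V x φ ∧ Forces R V x ψ
  | x, .or φ ψ => ∃ y z, Forces R V y φ ∧ Forces R V z ψ ∧ y ⊓ z ≤ x
  | x, .box φ => ∀ y, R x y → Forces R V y φ
  | x, .dia φ => ∃ y, R x y ∧ Forces R V y φ

/-- The modal L-frame `F` validates `φ ⊴ ψ`. -/
def ModalLFrame.Validates {P : Type u} (F : ModalLFrame.{v}) (φ ψ : Form P) : Prop :=
  ∀ (V : P → Order.PFilter F.carrier) (x : F.carrier), Forces F.rel V x φ → Forces F.rel V x ψ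

/-- The logic `L(Γ)` is sound and complete with respect to the class `C` of modal L-frames. -/
def SoundAndComplete {P : Type u} (Γ : Set (ConsequencePair P)) (C : Set ModalLFrame.{v}) :
    Prop :=
  ∀ φ ψ : Form P, (∀ F ∈ C, F.Validates φ ψ) ↔ Derives Γ φ ψ

/-! ### Modal L-spaces -/

/-- HMS-spaces. -/
structure IsHMSSpace (X : Type w) [SemilatticeInf X] [OrderTop X] [TopologicalSpace X] :
    Prop where
  compact : CompactSpace X
  separation : ∀ x y : X, ¬ x ≤ y → ∃ U : Order.PFilter X, IsClopen (U : Set X) ∧ x ∈ U ∧ y ∉ U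

/-- The filter generated by the union of the filters `U` and `V`. -/
def filterJoin {X : Type w} [SemilatticeInf X] (U V : Set X) : Set X :=
  {x | ∃ y ∈ U, ∃ z ∈ V, y ⊓ z ≤ x}

/-- L-spaces. -/
structure IsLSpace (X : Type w) [SemilatticeInf X] [OrderTop X] [TopologicalSpace X] : Prop
    extends IsHMSSpace X where
  isClopen_top : IsClopen ({⊤} : Set X)
  isClopen_join : ∀ U V : Order.PFilter X, IsClopen (U : Set X) → IsClopen (V : Set X) →
    IsClopen (filterJoin (U : Set X) (V : Set X))

/-- `□_R U`. -/
def boxR {X : Type w} (R : X → X → Prop) (U : Set X) : Set X := {x | ∀ y, R x y → y ∈ U}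

/-- `◇_R U`. -/
def diaR {X : Type w} (R : X → X → Prop) (U : Set X) : Set X := {x | ∃ y, R x y ∧ y ∈ U}

/-- `X` with the relation `R` is a modal L-space. The clause `serial` says that every `R[x]` is
nonempty; it is part of `(X, R)` being a modal L-frame, as the relation of a modal L-space is. -/
structure IsModalLSpace {X : Type w} [SemilatticeInf X] [OrderTop X] [TopologicalSpace X]
    (R : X → X → Prop) : Prop where
  isLSpace : IsLSpace X
  serial : ∀ x, ∃ y, R x y
  top_iff : ∀ x, R ⊤ x ↔ x = ⊤
  box_clopen : ∀ U : Order.PFilter X, IsClopen (U : Set X) →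
    Order.IsPFilter (boxR R (U : Set X)) ∧ IsClopen (boxR R (U : Set X))
  dia_clopen : ∀ U : Order.PFilter X, IsClopen (U : Set X) →
    Order.IsPFilter (diaR R (U : Set X)) ∧ IsClopen (diaR R (U : Set X))
  rel_iff : ∀ x y, R x y ↔ ∀ U : Order.PFilter X, IsClopen (U : Set X) →
    (x ∈ boxR R (U : Set X) → y ∈ U) ∧ (y ∈ U → x ∈ diaR R (U : Set X))

/-- L-morphisms between L-frames. -/
structure IsLMorphism {X Y : Type w} [SemilatticeInf X] [OrderTop X] [SemilatticeInf Y]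
    [OrderTop Y] (f : X → Y) : Prop where
  map_top : f ⊤ = ⊤
  map_inf : ∀ x y, f (x ⊓ y) = f x ⊓ f y
  eq_top : ∀ x, f x = ⊤ → x = ⊤
  inf_le : ∀ (x : X) (y' z' : Y), y' ⊓ z' ≤ f x → ∃ y z, y' ≤ f y ∧ z' ≤ f z ∧ y ⊓ z ≤ x

/-- Modal L-space morphisms: continuous bounded L-morphisms. -/
structure IsModalLSpaceMorphism {X Y : Type w} [SemilatticeInf X] [OrderTop X]
    [TopologicalSpace X] [SemilatticeInf Y] [OrderTop Y] [TopologicalSpace Y]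
    (R : X → X → Prop) (S : Y → Y → Prop) (f : X → Y) : Prop extends IsLMorphism f where
  continuous : Continuous f
  map_rel : ∀ x y, R x y → S (f x) (f y)
  back_le : ∀ x z, S (f x) z → ∃ y, R x y ∧ f y ≤ z
  back_ge : ∀ x z, S (f x) z → ∃ y, R x y ∧ z ≤ f y

/-- Isomorphism of modal L-spaces. -/
def ModalLSpaceIso {X Y : Type w} [SemilatticeInf X] [OrderTop X]
    [TopologicalSpace X] [SemilatticeInf Y] [OrderTop Y] [TopologicalSpace Y]
    (R : X → X → Prop) (S : Y → Y → Prop) : Prop :=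
  ∃ (f : X → Y) (g : Y → X), IsModalLSpaceMorphism R S f ∧ IsModalLSpaceMorphism S R g ∧
    Function.LeftInverse g f ∧ Function.RightInverse g f

/-! ### The dual `Fil_L(A)` of a modal lattice `A`

Its points are the filters of `A`, including `A` itself, ordered by inclusion. -/

theorem isPFilter_inter {A : Type w} [Lattice A] [BoundedOrder A] (F G : Order.PFilter A) :
    Order.IsPFilter ((F : Set A) ∩ (G : Set A)) := by
  refine Order.IsPFilter.of_def ⟨⊤, Order.PFilter.top_mem, Order.PFilter.top_mem⟩ ?_ ?_
  · rintro a ⟨haF, haG⟩ b ⟨hbF, hbG⟩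
    exact ⟨a ⊓ b, ⟨Order.PFilter.inf_mem haF hbF, Order.PFilter.inf_mem haG hbG⟩,
      inf_le_left, inf_le_right⟩
  · rintro a b hab ⟨haF, haG⟩
    exact ⟨Order.PFilter.mem_of_le hab haF, Order.PFilter.mem_of_le hab haG⟩

/-- Meets of filters are intersections. -/
instance instSemilatticeInfPFilter {A : Type w} [Lattice A] [BoundedOrder A] :
    SemilatticeInf (Order.PFilter A) :=
  { (inferInstance : PartialOrder (Order.PFilter A)) with
    inf := fun F G => (isPFilter_inter F G).toPFilter
    inf_le_left := fun _ _ _ ha => ha.1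
    inf_le_right := fun _ _ _ ha => ha.2
    le_inf := fun _ _ _ h₁ h₂ _ ha => ⟨h₁ ha, h₂ ha⟩ }

/-- The topology generated by the sets `{F | a ∈ F}` and their complements. -/
instance instTopologicalSpacePFilter {A : Type w} [Lattice A] [BoundedOrder A] :
    TopologicalSpace (Order.PFilter A) :=
  TopologicalSpace.generateFrom
    {S | ∃ a : A, S = {F : Order.PFilter A | a ∈ F} ∨ S = {F : Order.PFilter A | a ∈ F}ᶜ}

/-- The relation on the filters of a modal lattice. -/
def dualRel (A : Type w) [ModalLattice A] (F G : Order.PFilter A) : Prop :=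
  ∀ a : A, (ModalLattice.box a ∈ F → a ∈ G) ∧ (a ∈ G → ModalLattice.dia a ∈ F)

/-! ### The axioms T, 4, B, 5, .2 and their first order conditions -/

/-- Names for the five axioms T, 4, B, 5 and .2. -/
inductive AxiomName
  | T
  | four
  | B
  | five
  | dotTwo

/-- The consequence pairs of each axiom, written with the propositional letter `p`. -/
def AxiomName.pairs {P : Type u} (p : P) : AxiomName → Set (ConsequencePair P)
  | .T => {⟨.box (.var p), .var p⟩, ⟨.var p, .dia (.var p)⟩}
  | .four => {⟨.box (.var p), .box (.box (.var p))⟩, ⟨.dia (.dia (.var p)), .dia (.var p)⟩}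
  | .B => {⟨.var p, .box (.dia (.var p))⟩, ⟨.dia (.box (.var p)), .var p⟩}
  | .five => {⟨.dia (.var p), .box (.dia (.var p))⟩, ⟨.dia (.box (.var p)), .box (.var p)⟩}
  | .dotTwo => {⟨.dia (.box (.var p)), .box (.dia (.var p))⟩}

/-- Reflexivity, transitivity, symmetry, Euclideanity and directedness. -/
def AxiomName.Condition {X : Type v} (R : X → X → Prop) : AxiomName → Prop
  | .T => ∀ x, R x x
  | .four => ∀ x y z, R x y → R y z → R x z
  | .B => ∀ x y, R x y → R y x
  | .five => ∀ x y z, R x y → R x z → R y z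
  | .dotTwo => ∀ x y z, R x y → R x z → ∃ t, R y t ∧ R z t

/-- The set of consequence pairs given by a set of axioms. -/
def axiomPairs {P : Type u} (p : P) (Γ : Set AxiomName) : Set (ConsequencePair P) :=
  ⋃ a ∈ Γ, a.pairs p

/-- `R` satisfies the conditions `Θ_Γ` that correspond to the axioms in `Γ`. -/
def Theta {X : Type v} (Γ : Set AxiomName) (R : X → X → Prop) : Prop :=
  ∀ a ∈ Γ, a.Condition R

end WPML

open WPML

namespace WPML

open Order Set

/-! ### Algebraic form of the axioms -/

namespace ModalLattice

variable {A : Type w} [ModalLattice A] {a b : A}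

/-! The proof is a duality between modal lattices and modal L-spaces, with arbitrary filters as
points. Primeness is never needed: a disjunction is witnessed by two points whose meet lies below
the given one, and the principal filters of `a` and `b` meet in that of `a ⊔ b`.

In `dualRel A`, each filter `F` has a least successor `boxPreimage F`. If `dia a ∈ F` for all `a ∈
G`, the join of `boxPreimage F` and `G` is also a successor, by the duality inequality
(`dualRel_pfilterJoin`). These two witnesses yield the frame conditions, the truth lemma
`forces_dualRel_iff`, and the transfer of each axiom from `A` to its relational condition.
Conversely, a relational condition makes the axiom hold on filters of points by the usual Kripke
argument; this serves both soundness and the lattice of clopen filters.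

For the topological part, compactness shows that the clopen filters of the dual are exactly those
given by elements of `A` (`exists_eq_containing`), so the dual is a modal L-space. Compactness and
separation show that a modal L-space is isomorphic to the dual of its lattice of clopen filters
(`IsModalLSpace.iso_dualRel`). Completeness applies the truth lemma to a Lindenbaum algebra on
countably many letters, whose universe can be chosen to match that of the frames. -/

theorem box_mono (h : a ≤ b) : box a ≤ box b := by
  rw [← inf_eq_left] at h ⊢
  rw [box_inf_box, h]

theorem dia_mono (h : a ≤ b) : dia a ≤ dia b := by
  have := dia_sup_dia_le a b
  rw [sup_eq_right.2 h] at this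
  exact le_sup_left.trans this

theorem box_le_dia (a : A) : box a ≤ dia a := by
  have := dia_inf_box_le ⊤ a
  rwa [dia_top, top_inf_eq, top_inf_eq] at this

end ModalLattice

open ModalLattice

/-- The inequalities expressed by each axiom in a modal lattice. -/
def AxiomName.Holds (A : Type w) [ModalLattice A] : AxiomName → Prop
  | .T => ∀ a : A, box a ≤ a ∧ a ≤ dia a
  | .four => ∀ a : A, box a ≤ box (box a) ∧ dia (dia a) ≤ dia a
  | .B => ∀ a : A, a ≤ box (dia a) ∧ dia (box a) ≤ a
  | .five => ∀ a : A, dia a ≤ box (dia a) ∧ dia (box a) ≤ box a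
  | .dotTwo => ∀ a : A, dia (box a) ≤ box (dia a)

theorem AxiomName.holds_iff {P : Type u} (p : P) {A : Type w} [ModalLattice A] (n : AxiomName) :
    n.Holds A ↔ ∀ c ∈ n.pairs p, ∀ σ : P → A, c.lhs.eval σ ≤ c.rhs.eval σ := by
  constructor
  · intro h c hc σ
    cases n <;> simp only [AxiomName.pairs, mem_insert_iff, mem_singleton_iff] at hc
    case dotTwo => subst hc; exact h (σ p)
    all_goals
      rcases hc with rfl | rfl
      · exact (h (σ p)).1
      · exact (h (σ p)).2
  · intro h
    cases n
    -- Only the letter `p` occurs in the axioms, so constant assignments suffice.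
    case dotTwo => exact fun a => h _ rfl fun _ => a
    all_goals exact fun a => ⟨h _ (Or.inl rfl) fun _ => a, h _ (Or.inr rfl) fun _ => a⟩

theorem inVariety_axiomPairs_iff {P : Type u} (p : P) (Γ : Set AxiomName) (A : Type w)
    [ModalLattice A] : InVariety (axiomPairs p Γ) A ↔ ∀ n ∈ Γ, n.Holds A := by
  simp only [InVariety, axiomPairs, mem_iUnion, AxiomName.holds_iff p]
  exact ⟨fun h n hn c hc => h c ⟨n, hn, hc⟩, fun h c ⟨n, hn, hc⟩ => h n hn c hc⟩

/-! ### Soundness -/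

section Soundness

variable {P : Type u} {X : Type v} [SemilatticeInf X] [OrderTop X] {R : X → X → Prop}

theorem isPFilter_filterJoin {U V : Set X} (hU : IsPFilter U) (hV : IsPFilter V) :
    IsPFilter (filterJoin U V) := by
  refine IsPFilter.of_def ⟨⊤, ⊤, PFilter.top_mem (F := hU.toPFilter), ⊤,
    PFilter.top_mem (F := hV.toPFilter), le_top⟩ ?_ ?_
  · rintro x ⟨y, hy, z, hz, h⟩ x' ⟨y', hy', z', hz', h'⟩
    refine ⟨x ⊓ x', ⟨y ⊓ y', PFilter.inf_mem (F := hU.toPFilter) hy hy', z ⊓ z',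
      PFilter.inf_mem (F := hV.toPFilter) hz hz', ?_⟩, inf_le_left, inf_le_right⟩
    rw [inf_inf_inf_comm]
    exact inf_le_inf h h'
  · rintro x x' hx ⟨y, hy, z, hz, h⟩
    exact ⟨y, hy, z, hz, h.trans hx⟩

theorem isPFilter_singleton_top : IsPFilter ({⊤} : Set X) :=
  IsPFilter.of_def ⟨⊤, rfl⟩ (by rintro x rfl y rfl; exact ⟨⊤, rfl, le_rfl, le_rfl⟩)
    fun {x y} h hx => top_le_iff.1 (mem_singleton_iff.1 hx ▸ h)

/-- Upward closure comes from `back_le`, closure under meets from `of_inf`; for `diaR`, `forth_le`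
and `inf` play these roles. -/
theorem IsModalLFrame.isPFilter_boxR (hR : IsModalLFrame R) {U : Set X} (hU : IsPFilter U) :
    IsPFilter (boxR R U) := by
  refine IsPFilter.of_def ⟨⊤, fun y hy => ?_⟩ ?_ ?_
  · rw [(hR.top_iff y).1 hy]; exact PFilter.top_mem (F := hU.toPFilter)
  · refine fun x hx y hy => ⟨x ⊓ y, fun z hz => ?_, inf_le_left, inf_le_right⟩
    obtain ⟨u, v, hu, hv, h⟩ := hR.of_inf x y z hz
    exact PFilter.mem_of_le (F := hU.toPFilter) h
      (PFilter.inf_mem (F := hU.toPFilter) (hx u hu) (hy v hv))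
  · intro x y hxy hx z hz
    obtain ⟨w, hw, hwz⟩ := hR.back_le x y z hxy hz
    exact PFilter.mem_of_le (F := hU.toPFilter) hwz (hx w hw)

theorem IsModalLFrame.isPFilter_diaR (hR : IsModalLFrame R) {U : Set X} (hU : IsPFilter U) :
    IsPFilter (diaR R U) := by
  refine IsPFilter.of_def ⟨⊤, ⊤, (hR.top_iff ⊤).2 rfl, PFilter.top_mem (F := hU.toPFilter)⟩ ?_ ?_
  · rintro x ⟨u, hu, huU⟩ y ⟨v, hv, hvU⟩
    exact ⟨x ⊓ y, ⟨u ⊓ v, hR.inf x y u v hu hv, PFilter.inf_mem (F := hU.toPFilter) huU hvU⟩,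
      inf_le_left, inf_le_right⟩
  · rintro x y hxy ⟨u, hu, huU⟩
    obtain ⟨z, hz, huz⟩ := hR.forth_le x y u hxy hu
    exact ⟨z, hz, PFilter.mem_of_le (F := hU.toPFilter) huz huU⟩

/-- The top point sees itself, and `back_le` pulls this down to any `x ≤ ⊤`. -/
theorem IsModalLFrame.serial (hR : IsModalLFrame R) (x : X) : ∃ y, R x y :=
  let ⟨w, hw, _⟩ := hR.back_le x ⊤ ⊤ le_top ((hR.top_iff ⊤).2 rfl)
  ⟨w, hw⟩

/-- Truth sets are filters. -/
theorem IsModalLFrame.isPFilter_forces (hR : IsModalLFrame R) (V : P → PFilter X) :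
    ∀ φ : Form P, IsPFilter {x | Forces R V x φ}
  | .var q => (V q).isPFilter
  | .top => IsPFilter.of_def ⟨⊤, trivial⟩
      (fun x _ y _ => ⟨x ⊓ y, trivial, inf_le_left, inf_le_right⟩) fun _ _ => trivial
  | .bot => isPFilter_singleton_top
  | .and φ ψ => by
    have hφ := hR.isPFilter_forces V φ
    have hψ := hR.isPFilter_forces V ψ
    refine IsPFilter.of_def
      ⟨⊤, PFilter.top_mem (F := hφ.toPFilter), PFilter.top_mem (F := hψ.toPFilter)⟩ ?_ ?_
    · exact fun x hx y hy => ⟨x ⊓ y, ⟨PFilter.inf_mem (F := hφ.toPFilter) hx.1 hy.1,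
        PFilter.inf_mem (F := hψ.toPFilter) hx.2 hy.2⟩, inf_le_left, inf_le_right⟩
    · exact fun h hx => ⟨PFilter.mem_of_le (F := hφ.toPFilter) h hx.1,
        PFilter.mem_of_le (F := hψ.toPFilter) h hx.2⟩
  | .or φ ψ => by
    have := isPFilter_filterJoin (hR.isPFilter_forces V φ) (hR.isPFilter_forces V ψ)
    convert this using 1
    ext x
    simp only [Forces, filterJoin, mem_ofPred_eq]
    exact ⟨fun ⟨y, z, hy, hz, h⟩ => ⟨y, hy, z, hz, h⟩, fun ⟨y, hy, z, hz, h⟩ => ⟨y, z, hy, hz, h⟩⟩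
  | .box φ => hR.isPFilter_boxR (hR.isPFilter_forces V φ)
  | .dia φ => hR.isPFilter_diaR (hR.isPFilter_forces V φ)

/-- The truth set of a formula, as a filter. -/
def truthFilter (hR : IsModalLFrame R) (V : P → PFilter X) (φ : Form P) : PFilter X :=
  (hR.isPFilter_forces V φ).toPFilter

/-- A substitution amounts to a change of valuation; the new valuation is admissible because truth
sets are filters. -/
theorem forces_subst (hR : IsModalLFrame R) (V : P → PFilter X) (σ : P → Form P) (φ : Form P)
    (x : X) : Forces R V x (φ.subst σ) ↔ Forces R (fun q => truthFilter hR V (σ q)) x φ := by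
  induction φ generalizing x with
  | var q => exact Iff.rfl
  | top => exact Iff.rfl
  | bot => exact Iff.rfl
  | and φ ψ hφ hψ => simp only [Form.subst, Forces, hφ, hψ]
  | or φ ψ hφ hψ => simp only [Form.subst, Forces, hφ, hψ]
  | box φ hφ => simp only [Form.subst, Forces, hφ]
  | dia φ hφ => simp only [Form.subst, Forces, hφ]

theorem AxiomName.Condition.forces {n : AxiomName} (hn : n.Condition R) (p : P)
    {c : ConsequencePair P} (hc : c ∈ n.pairs p) (V : P → PFilter X) (x : X)
    (hx : Forces R V x c.lhs) : Forces R V x c.rhs := by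
  cases n <;> simp only [AxiomName.pairs, mem_insert_iff, mem_singleton_iff] at hc
  case T =>
    rcases hc with rfl | rfl
    · exact hx x (hn x)
    · exact ⟨x, hn x, hx⟩
  case four =>
    rcases hc with rfl | rfl
    · exact fun y hy z hz => hx z (hn x y z hy hz)
    · obtain ⟨y, hy, z, hz, h⟩ := hx
      exact ⟨z, hn x y z hy hz, h⟩
  case B =>
    rcases hc with rfl | rfl
    · exact fun y hy => ⟨x, hn x y hy, hx⟩
    · obtain ⟨y, hy, h⟩ := hx
      exact h x (hn x y hy)
  case five =>
    rcases hc with rfl | rfl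
    · obtain ⟨y, hy, h⟩ := hx
      exact fun z hz => ⟨y, hn x z y hz hy, h⟩
    · obtain ⟨y, hy, h⟩ := hx
      exact fun z hz => h z (hn x y z hy hz)
  case dotTwo =>
    subst hc
    obtain ⟨y, hy, h⟩ := hx
    intro z hz
    obtain ⟨t, ht, ht'⟩ := hn x y z hy hz
    exact ⟨t, ht', h t ht⟩

theorem Derives.forces {Γ : Set AxiomName} {p : P} {φ ψ : Form P}
    (h : Derives (axiomPairs p Γ) φ ψ) (hR : IsModalLFrame R) (hΓ : Theta Γ R)
    (V : P → PFilter X) (x : X) (hx : Forces R V x φ) : Forces R V x ψ := by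
  induction h generalizing V x with
  | ax hc =>
    simp only [axiomPairs, mem_iUnion] at hc
    obtain ⟨n, hn, hc⟩ := hc
    exact (hΓ n hn).forces p hc V x hx
  | subst σ _ ih =>
    rw [forces_subst hR] at hx ⊢
    exact ih _ _ hx
  | top => trivial
  | bot ψ =>
    have hx : x = ⊤ := hx
    rw [hx]
    exact PFilter.top_mem (F := truthFilter hR V ψ)
  | refl => exact hx
  | trans _ _ ih₁ ih₂ => exact ih₂ V x (ih₁ V x hx)
  | and_left => exact hx.1
  | and_right => exact hx.2
  | or_left φ ψ => exact ⟨x, ⊤, hx, PFilter.top_mem (F := truthFilter hR V ψ), inf_le_left⟩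
  | or_right φ ψ => exact ⟨⊤, x, PFilter.top_mem (F := truthFilter hR V φ), hx, inf_le_right⟩
  | and_intro _ _ ih₁ ih₂ => exact ⟨ih₁ V x hx, ih₂ V x hx⟩
  | @or_elim φ ψ χ _ _ ih₁ ih₂ =>
    obtain ⟨y, z, hy, hz, h⟩ := hx
    exact PFilter.mem_of_le (F := truthFilter hR V χ) h
      (PFilter.inf_mem (F := truthFilter hR V χ) (ih₁ V y hy) (ih₂ V z hz))
  | box_top => exact fun _ _ => trivial
  | dia_top => exact (hR.serial x).imp fun _ h => ⟨h, trivial⟩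
  | box_mono _ ih => exact fun y hy => ih V y (hx y hy)
  | dia_mono _ ih => exact Exists.imp (fun y hy => ⟨hy.1, ih V y hy.2⟩) hx
  | linearity => exact fun y hy => ⟨hx.1 y hy, hx.2 y hy⟩
  | duality =>
    obtain ⟨⟨y, hy, h⟩, hb⟩ := hx
    exact ⟨y, hy, h, hb y hy⟩

end Soundness

/-! ### The dual of a modal lattice as a modal L-frame -/

section Dual

variable {A : Type w}

theorem PFilter.eq_top_iff_bot_mem [Lattice A] [BoundedOrder A] {F : PFilter A} :
    F = ⊤ ↔ ⊥ ∈ F :=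
  ⟨fun h => h ▸ (trivial : (⊥ : A) ∈ (⊤ : PFilter A)),
    fun h => top_le_iff.1 fun _ _ => PFilter.mem_of_le bot_le h⟩

/-- A common upper bound of `a` and `b` is an element above `a ⊔ b`. This replaces primeness in the
treatment of disjunction. -/
theorem PFilter.principal_inf_principal_le [Lattice A] [BoundedOrder A] {F : PFilter A}
    {a b : A} : PFilter.principal a ⊓ PFilter.principal b ≤ F ↔ a ⊔ b ∈ F :=
  ⟨fun h => h ⟨le_sup_left, le_sup_right⟩,
    fun h _ hc => PFilter.mem_of_le (sup_le hc.1 hc.2) h⟩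

/-- The filter generated by the union of two filters. -/
def pfilterJoin [Lattice A] [BoundedOrder A] (F G : PFilter A) : PFilter A :=
  (isPFilter_filterJoin F.isPFilter G.isPFilter).toPFilter

theorem mem_pfilterJoin [Lattice A] [BoundedOrder A] {F G : PFilter A} {a : A} :
    a ∈ pfilterJoin F G ↔ ∃ b ∈ F, ∃ c ∈ G, b ⊓ c ≤ a := Iff.rfl

theorem left_le_pfilterJoin [Lattice A] [BoundedOrder A] (F G : PFilter A) :
    F ≤ pfilterJoin F G := fun a ha => ⟨a, ha, ⊤, PFilter.top_mem, inf_le_left⟩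

theorem right_le_pfilterJoin [Lattice A] [BoundedOrder A] (F G : PFilter A) :
    G ≤ pfilterJoin F G := fun a ha => ⟨⊤, PFilter.top_mem, a, ha, inf_le_right⟩

variable [ModalLattice A]

/-- The filter `{a | □a ∈ F}`. -/
def boxPreimage (F : PFilter A) : PFilter A :=
  (IsPFilter.of_def (F := {a | box a ∈ F}) ⟨⊤, by simp [box_top]⟩
    (fun a ha b hb => ⟨a ⊓ b, by
      simp only [mem_ofPred_eq, ← box_inf_box]
      exact PFilter.inf_mem ha hb, inf_le_left, inf_le_right⟩)
    fun h ha => PFilter.mem_of_le (box_mono h) ha).toPFilter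

theorem dualRel_boxPreimage (F : PFilter A) : dualRel A F (boxPreimage F) :=
  fun a => ⟨id, fun h => PFilter.mem_of_le (box_le_dia a) h⟩

/-- If `b ⊓ c ≤ a` with `box b ∈ F` and `c ∈ G`, then `dia c ⊓ box b ∈ F`, and the duality
inequality puts `dia a` in `F`. -/
theorem dualRel_pfilterJoin {F G : PFilter A} (h : ∀ a ∈ G, dia a ∈ F) :
    dualRel A F (pfilterJoin (boxPreimage F) G) := by
  refine fun a => ⟨fun ha => left_le_pfilterJoin _ _ ha, ?_⟩
  rintro ⟨b, hb, c, hc, hbc⟩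
  refine PFilter.mem_of_le ((dia_inf_box_le c b).trans (dia_mono ?_))
    (PFilter.inf_mem (h c hc) hb)
  rwa [inf_comm]

/-- Downward witnesses (`back_le`, `of_inf`) are the least successors; the upward witness
(`forth_le`) enlarges the least successor of `F'` by the given filter `H`. -/
theorem isModalLFrame_dualRel : IsModalLFrame (dualRel A) where
  back_le F F' G h hG := ⟨boxPreimage F, dualRel_boxPreimage F, fun a ha => (hG a).1 (h ha)⟩
  forth_le F F' H h hH := ⟨pfilterJoin (boxPreimage F') H,
    dualRel_pfilterJoin fun a ha => h ((hH a).2 ha), right_le_pfilterJoin _ _⟩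
  of_inf F F' G hG := ⟨boxPreimage F, boxPreimage F', dualRel_boxPreimage F,
    dualRel_boxPreimage F', fun a ha => (hG a).1 ⟨ha.1, ha.2⟩⟩
  inf F F' G G' h h' := fun a => ⟨fun ha => ⟨(h a).1 ha.1, (h' a).1 ha.2⟩,
    fun ha => ⟨(h a).2 ha.1, (h' a).2 ha.2⟩⟩
  top_iff G := by
    refine ⟨fun h => PFilter.eq_top_iff_bot_mem.2 ((h ⊥).1 trivial), ?_⟩
    rintro rfl
    exact fun a => ⟨fun _ => trivial, fun _ => trivial⟩

theorem box_mem_iff {F : PFilter A} {a : A} : box a ∈ F ↔ ∀ G, dualRel A F G → a ∈ G :=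
  ⟨fun h _ hG => (hG a).1 h, fun h => h _ (dualRel_boxPreimage F)⟩

theorem dia_mem_iff {F : PFilter A} {a : A} : dia a ∈ F ↔ ∃ G, dualRel A F G ∧ a ∈ G := by
  refine ⟨fun h => ⟨pfilterJoin (boxPreimage F) (PFilter.principal a),
    dualRel_pfilterJoin fun b hb => PFilter.mem_of_le (dia_mono hb) h,
    right_le_pfilterJoin _ _ (PFilter.mem_principal.2 le_rfl)⟩, ?_⟩
  rintro ⟨G, hG, ha⟩
  exact (hG a).2 ha

theorem AxiomName.Holds.condition_dualRel {n : AxiomName} (hn : n.Holds A) :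
    n.Condition (dualRel A) := by
  cases n
  case T =>
    exact fun F a => ⟨PFilter.mem_of_le (hn a).1, PFilter.mem_of_le (hn a).2⟩
  case four =>
    exact fun F G H hG hH a => ⟨fun h => (hH a).1 ((hG _).1 (PFilter.mem_of_le (hn a).1 h)),
      fun h => PFilter.mem_of_le (hn a).2 ((hG _).2 ((hH a).2 h))⟩
  case B =>
    exact fun F G h a => ⟨fun ha => PFilter.mem_of_le (hn a).2 ((h _).2 ha),
      fun ha => (h _).1 (PFilter.mem_of_le (hn a).1 ha)⟩
  case five =>
    exact fun F G H hG hH a => ⟨fun ha => (hH a).1 (PFilter.mem_of_le (hn a).2 ((hG _).2 ha)),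
      fun ha => (hG _).1 (PFilter.mem_of_le (hn a).1 ((hH a).2 ha))⟩
  case dotTwo =>
    intro F G H hG hH
    -- From `box a ∈ H` one gets `dia (box a) ∈ F`, hence `box (dia a) ∈ F` by the axiom, hence `dia
    -- a ∈ G`. So the join of the two box preimages is a successor of `G` and, symmetrically, of
    -- `H`.
    have key : ∀ {G H : PFilter A}, dualRel A F G → dualRel A F H → ∀ a ∈ boxPreimage H,
        dia a ∈ G := fun hG hH a ha => (hG _).1 (PFilter.mem_of_le (hn a) ((hH _).2 ha))
    refine ⟨pfilterJoin (boxPreimage G) (boxPreimage H), dualRel_pfilterJoin (key hG hH), ?_⟩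
    have hcomm : pfilterJoin (boxPreimage G) (boxPreimage H) =
        pfilterJoin (boxPreimage H) (boxPreimage G) := by
      apply SetLike.ext
      intro a
      simp only [mem_pfilterJoin]
      constructor <;> rintro ⟨b, hb, c, hc, h⟩ <;> exact ⟨c, hc, b, hb, by rwa [inf_comm]⟩
    rw [hcomm]
    exact dualRel_pfilterJoin (key hH hG)

theorem theta_dualRel {Γ : Set AxiomName} (h : ∀ n ∈ Γ, n.Holds A) : Theta Γ (dualRel A) :=
  fun n hn => (h n hn).condition_dualRel

/-- The filter of filters that contain `a`. -/
def containing {A : Type w} [Lattice A] [BoundedOrder A] (a : A) : PFilter (PFilter A) :=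
  PFilter.principal (PFilter.principal a)

theorem mem_containing {A : Type w} [Lattice A] [BoundedOrder A] {a : A} {F : PFilter A} :
    F ∈ containing a ↔ a ∈ F :=
  PFilter.mem_principal.trans PFilter.principal_le_iff

theorem coe_containing {A : Type w} [Lattice A] [BoundedOrder A] (a : A) :
    (containing a : Set (PFilter A)) = {F | a ∈ F} := Set.ext fun _ => mem_containing

/-- The truth lemma. -/
theorem forces_dualRel_iff {P : Type u} (σ : P → A) (φ : Form P) (F : PFilter A) :
    Forces (dualRel A) (fun q => containing (σ q)) F φ ↔ φ.eval σ ∈ F := by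
  induction φ generalizing F with
  | var q => exact mem_containing
  | top => exact iff_of_true trivial PFilter.top_mem
  | bot => exact PFilter.eq_top_iff_bot_mem
  | and φ ψ hφ hψ => simp only [Forces, Form.eval, PFilter.inf_mem_iff, hφ, hψ]
  | or φ ψ hφ hψ =>
    simp only [Forces, Form.eval, hφ, hψ, ← PFilter.principal_inf_principal_le]
    refine ⟨fun ⟨G, H, hG, hH, h⟩ => le_trans (inf_le_inf ?_ ?_) h,
      fun h => ⟨_, _, PFilter.mem_principal.2 le_rfl, PFilter.mem_principal.2 le_rfl, h⟩⟩
    · exact PFilter.principal_le_iff.2 hG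
    · exact PFilter.principal_le_iff.2 hH
  | box φ hφ => simp only [Forces, Form.eval, box_mem_iff, hφ]
  | dia φ hφ => simp only [Forces, Form.eval, dia_mem_iff, hφ]

end Dual

/-! ### Completeness -/

section Completeness

variable {P : Type u}

/-- Renaming of letters. -/
def Form.rename {Q : Type v} (e : Q → P) : Form Q → Form P
  | .var q => .var (e q)
  | .top => .top
  | .bot => .bot
  | .and φ ψ => .and (φ.rename e) (ψ.rename e)
  | .or φ ψ => .or (φ.rename e) (ψ.rename e)
  | .box φ => .box (φ.rename e)
  | .dia φ => .dia (φ.rename e)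

/-- Every formula uses only finitely many letters. -/
theorem Form.exists_finite_letters (φ : Form P) : ∃ s : Set P, s.Finite ∧
    ∀ {Q : Type v} (e : Q → P), s ⊆ range e → ∃ φ' : Form Q, φ'.rename e = φ := by
  induction φ with
  | var q =>
    refine ⟨{q}, finite_singleton q, fun e he => ?_⟩
    obtain ⟨r, hr⟩ := he rfl
    exact ⟨.var r, congrArg Form.var hr⟩
  | top => exact ⟨∅, finite_empty, fun _ _ => ⟨.top, rfl⟩⟩
  | bot => exact ⟨∅, finite_empty, fun _ _ => ⟨.bot, rfl⟩⟩
  | and φ ψ hφ hψ =>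
    obtain ⟨s, hs, h⟩ := hφ
    obtain ⟨t, ht, h'⟩ := hψ
    refine ⟨s ∪ t, hs.union ht, fun e he => ?_⟩
    obtain ⟨φ', rfl⟩ := h e (subset_union_left.trans he)
    obtain ⟨ψ', rfl⟩ := h' e (subset_union_right.trans he)
    exact ⟨.and φ' ψ', rfl⟩
  | or φ ψ hφ hψ =>
    obtain ⟨s, hs, h⟩ := hφ
    obtain ⟨t, ht, h'⟩ := hψ
    refine ⟨s ∪ t, hs.union ht, fun e he => ?_⟩
    obtain ⟨φ', rfl⟩ := h e (subset_union_left.trans he)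
    obtain ⟨ψ', rfl⟩ := h' e (subset_union_right.trans he)
    exact ⟨.or φ' ψ', rfl⟩
  | box φ hφ =>
    obtain ⟨s, hs, h⟩ := hφ
    refine ⟨s, hs, fun e he => ?_⟩
    obtain ⟨φ', rfl⟩ := h e he
    exact ⟨.box φ', rfl⟩
  | dia φ hφ =>
    obtain ⟨s, hs, h⟩ := hφ
    refine ⟨s, hs, fun e he => ?_⟩
    obtain ⟨φ', rfl⟩ := h e he
    exact ⟨.dia φ', rfl⟩

/-- Any two formulas are renamings of formulas over a countable set of letters in `Type v`. -/
theorem Form.exists_rename (p : P) (φ ψ : Form P) :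
    ∃ (e : ULift.{v} ℕ → P) (φ' ψ' : Form (ULift.{v} ℕ)), φ'.rename e = φ ∧ ψ'.rename e = ψ := by
  obtain ⟨s, hs, h⟩ := φ.exists_finite_letters
  obtain ⟨t, ht, h'⟩ := ψ.exists_finite_letters
  -- Inserting `p` makes the finite set nonempty, so that `ℕ` maps onto it. The map repeats letters,
  -- which is harmless since derivability is tested after renaming.
  obtain ⟨f, hf⟩ := ((hs.union ht).insert p).countable.exists_eq_range (insert_nonempty p _)
  have hr : range (fun n : ULift.{v} ℕ => f n.down) = range f :=
    ULift.down_surjective.range_comp f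
  have hsub : s ∪ t ⊆ range (fun n : ULift.{v} ℕ => f n.down) := by
    rw [hr, ← hf]
    exact subset_insert _ _
  obtain ⟨φ', hφ'⟩ := h _ (subset_union_left.trans hsub)
  obtain ⟨ψ', hψ'⟩ := h' _ (subset_union_right.trans hsub)
  exact ⟨_, φ', ψ', hφ', hψ'⟩

variable {Q : Type v} (Δ : Set (ConsequencePair P)) (e : Q → P)

/-- Interderivability of renamings along `e`. -/
def interderivable : Setoid (Form Q) where
  r φ ψ := Derives Δ (φ.rename e) (ψ.rename e) ∧ Derives Δ (ψ.rename e) (φ.rename e)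
  iseqv := ⟨fun _ => ⟨.refl _, .refl _⟩, And.symm,
    fun h h' => ⟨h.1.trans h'.1, h'.2.trans h.2⟩⟩

/-- The Lindenbaum algebra of a logic, restricted to formulas with letters from `Q`. -/
def Lindenbaum : Type v := Quotient (interderivable Δ e)

/-- The class of a formula in the Lindenbaum algebra. -/
def Lindenbaum.mk (φ : Form Q) : Lindenbaum Δ e := Quotient.mk (interderivable Δ e) φ

theorem Derives.and_mono {Δ : Set (ConsequencePair P)} {φ φ' ψ ψ' : Form P}
    (h : Derives Δ φ φ') (h' : Derives Δ ψ ψ') : Derives Δ (.and φ ψ) (.and φ' ψ') :=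
  .and_intro (.trans (.and_left _ _) h) (.trans (.and_right _ _) h')

theorem Derives.or_mono {Δ : Set (ConsequencePair P)} {φ φ' ψ ψ' : Form P}
    (h : Derives Δ φ φ') (h' : Derives Δ ψ ψ') : Derives Δ (.or φ ψ) (.or φ' ψ') :=
  .or_elim (.trans h (.or_left _ _)) (.trans h' (.or_right _ _))

instance : ModalLattice (Lindenbaum Δ e) where
  le := Quotient.lift₂ (fun φ ψ => Derives Δ (φ.rename e) (ψ.rename e))
    fun _ _ _ _ h h' => propext ⟨fun d => h.2.trans (d.trans h'.1),
      fun d => h.1.trans (d.trans h'.2)⟩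
  le_refl := by rintro ⟨φ⟩; exact .refl _
  le_trans := by rintro ⟨φ⟩ ⟨ψ⟩ ⟨χ⟩; exact .trans
  le_antisymm := by rintro ⟨φ⟩ ⟨ψ⟩ h h'; exact Quotient.sound ⟨h, h'⟩
  inf := Quotient.map₂ .and fun _ _ h _ _ h' => ⟨h.1.and_mono h'.1, h.2.and_mono h'.2⟩
  sup := Quotient.map₂ .or fun _ _ h _ _ h' => ⟨h.1.or_mono h'.1, h.2.or_mono h'.2⟩
  inf_le_left := by rintro ⟨φ⟩ ⟨ψ⟩; exact .and_left _ _
  inf_le_right := by rintro ⟨φ⟩ ⟨ψ⟩; exact .and_right _ _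
  le_inf := by rintro ⟨φ⟩ ⟨ψ⟩ ⟨χ⟩; exact .and_intro
  le_sup_left := by rintro ⟨φ⟩ ⟨ψ⟩; exact .or_left _ _
  le_sup_right := by rintro ⟨φ⟩ ⟨ψ⟩; exact .or_right _ _
  sup_le := by rintro ⟨φ⟩ ⟨ψ⟩ ⟨χ⟩; exact .or_elim
  top := Lindenbaum.mk Δ e .top
  bot := Lindenbaum.mk Δ e .bot
  le_top := by rintro ⟨φ⟩; exact .top _
  bot_le := by rintro ⟨φ⟩; exact .bot _
  box := Quotient.map .box fun _ _ h => ⟨h.1.box_mono, h.2.box_mono⟩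
  dia := Quotient.map .dia fun _ _ h => ⟨h.1.dia_mono, h.2.dia_mono⟩
  box_top := Quotient.sound ⟨.top _, .box_top⟩
  dia_top := Quotient.sound ⟨.top _, .dia_top⟩
  box_inf_box := by
    rintro ⟨φ⟩ ⟨ψ⟩
    exact Quotient.sound ⟨.linearity _ _,
      .and_intro (.box_mono (.and_left _ _)) (.box_mono (.and_right _ _))⟩
  dia_sup_dia_le := by
    rintro ⟨φ⟩ ⟨ψ⟩
    exact .or_elim (.dia_mono (.or_left _ _)) (.dia_mono (.or_right _ _))
  dia_inf_box_le := by rintro ⟨φ⟩ ⟨ψ⟩; exact .duality _ _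

/-- Closure under substitution gives each axiom at an arbitrary formula: all letters are sent to
that formula, as only `p` matters. -/
theorem Lindenbaum.holds (p : P) (Γ : Set AxiomName) {n : AxiomName} (hn : n ∈ Γ) :
    n.Holds (Lindenbaum (axiomPairs p Γ) e) := by
  have h : ∀ c ∈ n.pairs p, ∀ φ : Form P, Derives (axiomPairs p Γ)
      (c.lhs.subst fun _ => φ) (c.rhs.subst fun _ => φ) := fun c hc φ =>
    .subst _ (.ax (mem_biUnion hn hc))
  cases n
  case dotTwo => rintro ⟨φ⟩; exact h _ rfl (φ.rename e)
  all_goals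
    rintro ⟨φ⟩
    exact ⟨h _ (Or.inl rfl) (φ.rename e), h _ (Or.inr rfl) (φ.rename e)⟩

/-- The valuation of the letters in the range of `e` by their classes. -/
noncomputable def Lindenbaum.valuation : P → Lindenbaum Δ e :=
  Function.extend e (fun q => mk Δ e (.var q)) fun _ => ⊤

theorem Lindenbaum.eval_valuation (φ : Form Q) :
    (φ.rename e).eval (valuation Δ e) = mk Δ e φ := by
  induction φ with
  | var q =>
    -- `e` need not be injective, but letters with the same image have interderivable renamings,
    -- hence the same class.
    have h : Function.FactorsThrough (fun q => mk Δ e (.var q)) e := fun q r h =>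
      Quotient.sound (by constructor <;> simp only [Form.rename, h] <;> exact .refl _)
    simpa only [Form.rename, Form.eval, valuation] using h.extend_apply (fun _ => ⊤) q
  | top => rfl
  | bot => rfl
  | and φ ψ hφ hψ => simp only [Form.rename, Form.eval, hφ, hψ]; rfl
  | or φ ψ hφ hψ => simp only [Form.rename, Form.eval, hφ, hψ]; rfl
  | box φ hφ => simp only [Form.rename, Form.eval, hφ]; rfl
  | dia φ hφ => simp only [Form.rename, Form.eval, hφ]; rfl

end Completeness

theorem soundAndComplete_theta {P : Type u} (p : P) (Γ : Set AxiomName) :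
    SoundAndComplete (axiomPairs p Γ) {F : ModalLFrame.{v} | Theta Γ F.rel} := by
  refine fun φ ψ => ⟨fun h => ?_, fun h F hF V x => h.forces F.isModalLFrame hF V x⟩
  obtain ⟨e, φ', ψ', rfl, rfl⟩ := Form.exists_rename.{u, v} p φ ψ
  -- At the principal filter of the class of `φ'` the truth lemma turns validity into the inequality
  -- between the two classes, which is derivability.
  have := h ⟨PFilter (Lindenbaum (axiomPairs p Γ) e), dualRel _, isModalLFrame_dualRel⟩
    (theta_dualRel fun n hn => Lindenbaum.holds e p Γ hn)
    (fun q => containing (Lindenbaum.valuation _ e q)) (PFilter.principal (Lindenbaum.mk _ e φ'))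
  simp only [forces_dualRel_iff, Lindenbaum.eval_valuation, PFilter.mem_principal] at this
  exact this le_rfl

/-! ### The dual of a modal lattice as a modal L-space -/

theorem PFilter.finsetInf_mem {X : Type w} [SemilatticeInf X] [OrderTop X] (U : PFilter X)
    {ι : Type*} (s : Finset ι) (f : ι → X) (h : ∀ i ∈ s, f i ∈ U) : s.inf f ∈ U :=
  Finset.inf_induction PFilter.top_mem (fun _ ha _ hb => PFilter.inf_mem ha hb) h

section DualTopology

variable {A : Type w} [Lattice A] [BoundedOrder A]

theorem isClopen_mem (a : A) : IsClopen {F : PFilter A | a ∈ F} :=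
  ⟨⟨TopologicalSpace.isOpen_generateFrom_of_mem ⟨a, Or.inr rfl⟩⟩,
    TopologicalSpace.isOpen_generateFrom_of_mem ⟨a, Or.inl rfl⟩⟩

theorem isClopen_containing (a : A) : IsClopen (containing a : Set (PFilter A)) :=
  coe_containing a ▸ isClopen_mem a

/-- An ultrafilter `u` converges to the filter of those `a` for which `u`-almost all filters contain
`a`. -/
instance : CompactSpace (PFilter A) := by
  refine ⟨isCompact_iff_ultrafilter_le_nhds.2 fun u _ => ?_⟩
  have hF : IsPFilter {a : A | {G : PFilter A | a ∈ G} ∈ u} := by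
    refine IsPFilter.of_def ⟨⊤, ?_⟩ (fun a ha b hb => ⟨a ⊓ b, ?_, inf_le_left, inf_le_right⟩) ?_
    · exact Filter.univ_mem' fun _ => PFilter.top_mem
    · filter_upwards [ha, hb] with G h h' using PFilter.inf_mem h h'
    · intro a b hab ha
      filter_upwards [ha] with G h using PFilter.mem_of_le hab h
  refine ⟨hF.toPFilter, mem_univ _, ?_⟩
  rw [← Filter.tendsto_id', TopologicalSpace.tendsto_nhds_generateFrom_iff]
  rintro s ⟨a, rfl | rfl⟩ ha
  · exact ha
  · exact Ultrafilter.compl_mem_iff_notMem.2 ha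

instance : T2Space (PFilter A) := by
  have key : ∀ {F G : PFilter A}, ¬ F ≤ G → ∃ u v : Set (PFilter A), IsOpen u ∧ IsOpen v ∧
      F ∈ u ∧ G ∈ v ∧ Disjoint u v := fun {F G} h => by
    obtain ⟨a, ha, ha'⟩ := SetLike.not_le_iff_exists.1 h
    exact ⟨_, _, (isClopen_mem a).isOpen, (isClopen_mem a).compl.isOpen, ha, ha',
      disjoint_compl_right⟩
  refine ⟨fun F G h => ?_⟩
  by_cases hFG : F ≤ G
  · obtain ⟨u, v, hu, hv, hF, hG, hd⟩ := key fun h' => h (le_antisymm hFG h')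
    exact ⟨v, u, hv, hu, hG, hF, hd.symm⟩
  · exact key hFG

/-- Every clopen filter of the dual of `A` is given by an element of `A`. -/
theorem exists_eq_containing {U : PFilter (PFilter A)} (hU : IsClopen (U : Set (PFilter A))) :
    ∃ a : A, U = containing a := by
  -- A closed filter of the compact space has a least point: for each `b` missed by some member, ask
  -- for a point of `U` missing `b`. Finitely many such demands are met by a finite meet of members.
  obtain ⟨G, hGU, hG⟩ : ∃ G ∈ U, ∀ F ∈ U, G ≤ F := by
    obtain ⟨G, hGU, hG⟩ := hU.isClosed.isCompact.inter_iInter_nonempty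
      (fun b : {b : A // ∃ F ∈ U, b ∉ F} => {F : PFilter A | b.1 ∈ F}ᶜ)
      (fun b => (isClopen_mem b.1).compl.isClosed) fun s => by
        choose F hFU hF using fun b : {b : A // ∃ F ∈ U, b ∉ F} => b.2
        refine ⟨s.inf F, PFilter.finsetInf_mem U s F fun b _ => hFU b, ?_⟩
        simp only [mem_iInter]
        exact fun b hb h => hF b (Finset.inf_le (f := F) hb h)
    refine ⟨G, hGU, fun F hF b hb => ?_⟩
    by_contra hbF
    exact mem_iInter.1 hG ⟨b, F, hF, hbF⟩ hb
  -- Each `a ∈ G` satisfies `U ≤ containing a`. If equality never held, compactness of the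
  -- complement of `U` would give a point outside `U` above `G`, contradicting upward closure.
  by_contra! hne
  obtain ⟨H, hHU, hH⟩ := hU.compl.isClosed.isCompact.inter_iInter_nonempty
    (fun b : {b : A // b ∈ G} => {F : PFilter A | b.1 ∈ F})
    (fun b => (isClopen_mem b.1).isClosed) fun s => by
      have ha : s.inf Subtype.val ∈ G := PFilter.finsetInf_mem G s _ fun b _ => b.2
      have hlt : ¬ containing (s.inf Subtype.val) ≤ U := fun h =>
        hne _ (le_antisymm (fun F hF => mem_containing.2 (hG F hF ha)) h)
      obtain ⟨F, hF, hFU⟩ := SetLike.not_le_iff_exists.1 hlt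
      refine ⟨F, hFU, ?_⟩
      simp only [mem_iInter]
      exact fun b hb => PFilter.mem_of_le (Finset.inf_le hb) (mem_containing.1 hF)
  exact hHU (PFilter.mem_of_le (fun b hb => mem_iInter.1 hH ⟨b, hb⟩) hGU)

theorem filterJoin_containing (a b : A) :
    filterJoin (containing a : Set (PFilter A)) (containing b) = (containing (a ⊔ b)) := by
  ext F
  rw [SetLike.mem_coe, mem_containing, ← PFilter.principal_inf_principal_le]
  refine ⟨fun ⟨G, hG, H, hH, h⟩ => le_trans (inf_le_inf hG hH) h,
    fun h => ⟨_, ?_, _, ?_, h⟩⟩ <;> exact mem_containing.2 (PFilter.mem_principal.2 le_rfl)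

theorem isLSpace_pfilter : IsLSpace (PFilter A) where
  compact := inferInstance
  separation F G h := by
    obtain ⟨a, ha, ha'⟩ := SetLike.not_le_iff_exists.1 h
    exact ⟨containing a, isClopen_containing a, mem_containing.2 ha, mt mem_containing.1 ha'⟩
  isClopen_top := by
    convert isClopen_mem (⊥ : A) using 1
    ext F
    exact PFilter.eq_top_iff_bot_mem
  isClopen_join U V hU hV := by
    obtain ⟨a, rfl⟩ := exists_eq_containing hU
    obtain ⟨b, rfl⟩ := exists_eq_containing hV
    rw [filterJoin_containing]
    exact isClopen_containing _

end DualTopology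

theorem boxR_containing {A : Type w} [ModalLattice A] (a : A) :
    boxR (dualRel A) (containing a : Set (PFilter A)) = containing (box a) := by
  ext F
  simp only [boxR, SetLike.mem_coe, mem_containing, mem_ofPred_eq, box_mem_iff]

theorem diaR_containing {A : Type w} [ModalLattice A] (a : A) :
    diaR (dualRel A) (containing a : Set (PFilter A)) = containing (dia a) := by
  ext F
  simp only [diaR, SetLike.mem_coe, mem_containing, mem_ofPred_eq, dia_mem_iff]

theorem isModalLSpace_dualRel {A : Type w} [ModalLattice A] : IsModalLSpace (dualRel A) where
  isLSpace := isLSpace_pfilter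
  serial := isModalLFrame_dualRel.serial
  top_iff := isModalLFrame_dualRel.top_iff
  box_clopen U hU := by
    obtain ⟨a, rfl⟩ := exists_eq_containing hU
    rw [boxR_containing]
    exact ⟨PFilter.isPFilter _, isClopen_containing _⟩
  dia_clopen U hU := by
    obtain ⟨a, rfl⟩ := exists_eq_containing hU
    rw [diaR_containing]
    exact ⟨PFilter.isPFilter _, isClopen_containing _⟩
  rel_iff F G := by
    have key : ∀ a : A, ((F ∈ boxR (dualRel A) (containing a : Set (PFilter A)) →
        G ∈ containing a) ∧ (G ∈ containing a → F ∈ diaR (dualRel A) (containing a))) ↔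
        (box a ∈ F → a ∈ G) ∧ (a ∈ G → dia a ∈ F) := fun a => by
      rw [boxR_containing, diaR_containing, SetLike.mem_coe, SetLike.mem_coe, mem_containing,
        mem_containing, mem_containing]
    refine ⟨fun h U hU => ?_, fun h a => (key a).1 (h _ (isClopen_containing a))⟩
    obtain ⟨a, rfl⟩ := exists_eq_containing hU
    exact (key a).2 (h a)

/-! ### Transport along isomorphisms -/

theorem Theta.of_equiv {X Y : Type w} {R : X → X → Prop} {S : Y → Y → Prop} {Γ : Set AxiomName}
    (hS : Theta Γ S) (f : X ≃ Y) (hR : ∀ x y, R x y ↔ S (f x) (f y)) : Theta Γ R := by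
  intro n hn
  have := hS n hn
  cases n <;> simp only [AxiomName.Condition, hR] at this ⊢
  case dotTwo =>
    intro x y z hy hz
    obtain ⟨t, ht, ht'⟩ := this _ _ _ hy hz
    exact ⟨f.symm t, by simpa, by simpa⟩
  case T => exact fun x => this _
  case B => exact fun x y => this _ _
  all_goals exact fun x y z => this _ _ _

section Transport

variable {X Y : Type w} [SemilatticeInf X] [OrderTop X] [SemilatticeInf Y] [OrderTop Y]

theorem IsLMorphism.monotone {f : X → Y} (hf : IsLMorphism f) : Monotone f := fun x y h => by
  rw [← inf_eq_left] at h ⊢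
  rw [← hf.map_inf, h]

theorem isPFilter_preimage_orderIso (f : X ≃o Y) {U : Set Y} (hU : IsPFilter U) :
    IsPFilter (f ⁻¹' U) := by
  refine IsPFilter.of_def ⟨⊤, ?_⟩ (fun x hx y hy => ⟨x ⊓ y, ?_, inf_le_left, inf_le_right⟩) ?_
  · rw [mem_preimage, f.map_top]
    exact PFilter.top_mem (F := hU.toPFilter)
  · rw [mem_preimage, f.map_inf]
    exact PFilter.inf_mem (F := hU.toPFilter) hx hy
  · exact fun h hx => PFilter.mem_of_le (F := hU.toPFilter) (f.monotone h) hx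

variable [TopologicalSpace X] [TopologicalSpace Y] {R : X → X → Prop} {S : Y → Y → Prop}

/-- For an order isomorphism that preserves and reflects the relations, the back conditions are
automatic, with inverse images as witnesses. -/
theorem modalLSpaceIso_iff : ModalLSpaceIso R S ↔
    ∃ (f : X ≃o Y), Continuous f ∧ Continuous f.symm ∧ ∀ x y, R x y ↔ S (f x) (f y) := by
  constructor
  · rintro ⟨f, g, hf, hg, hgf, hfg⟩
    refine ⟨⟨⟨f, g, hgf, hfg⟩, fun {x y} => ⟨fun h => ?_, fun h => hf.monotone h⟩⟩,
      hf.continuous, hg.continuous, fun x y => ⟨hf.map_rel x y, fun h => ?_⟩⟩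
    · simpa [hgf x, hgf y] using hg.monotone h
    · simpa [hgf x, hgf y] using hg.map_rel _ _ h
  · rintro ⟨f, hf, hf', h⟩
    have key : ∀ {X Y : Type w} [SemilatticeInf X] [OrderTop X] [TopologicalSpace X]
        [SemilatticeInf Y] [OrderTop Y] [TopologicalSpace Y] {R : X → X → Prop}
        {S : Y → Y → Prop} (f : X ≃o Y), Continuous f → (∀ x y, R x y ↔ S (f x) (f y)) →
        IsModalLSpaceMorphism R S f := fun {X Y} _ _ _ _ _ _ {R S} f hf h =>
      { map_top := f.map_top
        map_inf := f.map_inf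
        eq_top := fun x hx => (map_eq_top_iff f).1 hx
        inf_le := fun x y z hyz => ⟨f.symm y, f.symm z, by simp, by simp, by
          rwa [← f.symm.map_inf, f.symm_apply_le]⟩
        continuous := hf
        map_rel := fun x y => (h x y).1
        back_le := fun x z hz => ⟨f.symm z, (h _ _).2 (by simpa using hz), by simp⟩
        back_ge := fun x z hz => ⟨f.symm z, (h _ _).2 (by simpa using hz), by simp⟩ }
    exact ⟨f, f.symm, key f hf h, key f.symm hf' fun x y => by simp [h],
      f.symm_apply_apply, f.apply_symm_apply⟩

theorem IsModalLSpace.of_orderIso (hS : IsModalLSpace S) (f : X ≃o Y) (hf : Continuous f)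
    (hf' : Continuous f.symm) (hR : ∀ x y, R x y ↔ S (f x) (f y)) : IsModalLSpace R := by
  -- Every clopen filter of `X` is pulled back from `Y`, so clauses quantified over clopen filters
  -- transfer.
  have hex : ∀ U : PFilter X, IsClopen (U : Set X) → ∃ V : PFilter Y, IsClopen (V : Set Y) ∧
      ∀ x, f x ∈ V ↔ x ∈ U := fun U hU =>
    ⟨(isPFilter_preimage_orderIso f.symm U.isPFilter).toPFilter, hU.preimage hf', fun x => by
      change f.symm (f x) ∈ U ↔ _
      rw [f.symm_apply_apply]⟩
  have hbox : ∀ (U : PFilter X) (V : PFilter Y), (∀ x, f x ∈ V ↔ x ∈ U) →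
      boxR R (U : Set X) = f ⁻¹' boxR S V := fun U V h => by
    ext x
    simp only [boxR, mem_ofPred_eq, mem_preimage, SetLike.mem_coe, hR, ← h]
    exact (f.toEquiv.forall_congr_left (p := fun y => S (f x) (f y) → f y ∈ V)).trans (by simp)
  have hdia : ∀ (U : PFilter X) (V : PFilter Y), (∀ x, f x ∈ V ↔ x ∈ U) →
      diaR R (U : Set X) = f ⁻¹' diaR S V := fun U V h => by
    ext x
    simp only [diaR, mem_ofPred_eq, mem_preimage, SetLike.mem_coe, hR, ← h]
    exact (f.toEquiv.exists_congr_left (p := fun y => S (f x) (f y) ∧ f y ∈ V)).trans (by simp)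
  exact
  { isLSpace :=
    { compact :=
        have := hS.isLSpace.compact
        ⟨by simpa using isCompact_univ.image hf'⟩
      separation := fun x y h => by
        obtain ⟨U, hU, hx, hy⟩ := hS.isLSpace.separation (f x) (f y) (by simpa using h)
        exact ⟨(isPFilter_preimage_orderIso f U.isPFilter).toPFilter, hU.preimage hf, hx, hy⟩
      isClopen_top := by
        convert hS.isLSpace.isClopen_top.preimage hf using 1
        ext x
        simp
      isClopen_join := fun U V hU hV => by
        obtain ⟨U', hU', hUU'⟩ := hex U hU
        obtain ⟨V', hV', hVV'⟩ := hex V hV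
        convert (hS.isLSpace.isClopen_join U' V' hU' hV').preimage hf using 1
        ext x
        simp only [filterJoin, mem_preimage, mem_ofPred_eq, SetLike.mem_coe, ← hUU', ← hVV']
        constructor
        · rintro ⟨y, hy, z, hz, h⟩
          exact ⟨f y, hy, f z, hz, by rwa [← f.map_inf, f.le_iff_le]⟩
        · rintro ⟨y, hy, z, hz, h⟩
          exact ⟨f.symm y, by simpa, f.symm z, by simpa, by
            rwa [← f.symm.map_inf, f.symm_apply_le]⟩ }
    serial := fun x => by
      obtain ⟨y, hy⟩ := hS.serial (f x)
      exact ⟨f.symm y, (hR _ _).2 (by simpa using hy)⟩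
    top_iff := fun x => by rw [hR, f.map_top, hS.top_iff, map_eq_top_iff]
    box_clopen := fun U hU => by
      obtain ⟨V, hV, h⟩ := hex U hU
      rw [hbox U V h]
      exact ⟨isPFilter_preimage_orderIso f (hS.box_clopen V hV).1,
        (hS.box_clopen V hV).2.preimage hf⟩
    dia_clopen := fun U hU => by
      obtain ⟨V, hV, h⟩ := hex U hU
      rw [hdia U V h]
      exact ⟨isPFilter_preimage_orderIso f (hS.dia_clopen V hV).1,
        (hS.dia_clopen V hV).2.preimage hf⟩
    rel_iff := fun x y => by
      rw [hR, hS.rel_iff]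
      constructor
      · intro h U hU
        obtain ⟨V, hV, hUV⟩ := hex U hU
        rw [hbox U V hUV, hdia U V hUV, ← hUV]
        exact h V hV
      · intro h V hV
        have := h (isPFilter_preimage_orderIso f V.isPFilter).toPFilter (hV.preimage hf)
        rwa [hbox _ V fun _ => Iff.rfl, hdia _ V fun _ => Iff.rfl] at this }

end Transport

/-! ### The modal lattice of clopen filters -/

section ClopenFilters

/-- The clopen filters of a topologized semilattice. -/
def ClopenFilter (X : Type w) [SemilatticeInf X] [TopologicalSpace X] : Type w :=
  {U : PFilter X // IsClopen (U : Set X)}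

variable {X : Type w} [SemilatticeInf X] [OrderTop X] [TopologicalSpace X] {R : X → X → Prop}

/-- The modal lattice of clopen filters of a modal L-space. -/
@[reducible]
def IsModalLSpace.clopenFilters (hR : IsModalLSpace R) : ModalLattice (ClopenFilter X) where
  le U V := U.1 ≤ V.1
  le_refl _ := le_rfl
  le_trans _ _ _ := le_trans
  le_antisymm _ _ h h' := Subtype.ext (le_antisymm h h')
  inf U V := ⟨(IsPFilter.of_def (F := (U.1 : Set X) ∩ V.1) ⟨⊤, PFilter.top_mem, PFilter.top_mem⟩
    (fun x hx y hy => ⟨x ⊓ y, ⟨PFilter.inf_mem hx.1 hy.1, PFilter.inf_mem hx.2 hy.2⟩,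
      inf_le_left, inf_le_right⟩)
    fun h hx => ⟨PFilter.mem_of_le h hx.1, PFilter.mem_of_le h hx.2⟩).toPFilter, U.2.inter V.2⟩
  inf_le_left _ _ _ h := h.1
  inf_le_right _ _ _ h := h.2
  le_inf _ _ _ h h' _ hx := ⟨h hx, h' hx⟩
  sup U V := ⟨(isPFilter_filterJoin U.1.isPFilter V.1.isPFilter).toPFilter,
    hR.isLSpace.isClopen_join _ _ U.2 V.2⟩
  le_sup_left _ _ x h := ⟨x, h, ⊤, PFilter.top_mem, inf_le_left⟩
  le_sup_right _ _ x h := ⟨⊤, PFilter.top_mem, x, h, inf_le_right⟩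
  sup_le := by
    rintro U V W h h' x ⟨y, hy, z, hz, hx⟩
    exact PFilter.mem_of_le hx (PFilter.inf_mem (h hy) (h' hz))
  top := ⟨(IsPFilter.of_def (F := univ) ⟨⊤, trivial⟩
    (fun x _ y _ => ⟨x ⊓ y, trivial, inf_le_left, inf_le_right⟩)
    fun _ _ => trivial).toPFilter, isClopen_univ⟩
  le_top _ _ _ := trivial
  bot := ⟨isPFilter_singleton_top.toPFilter, hR.isLSpace.isClopen_top⟩
  bot_le U := by
    rintro x rfl
    exact PFilter.top_mem (F := U.1)
  box U := ⟨(hR.box_clopen U.1 U.2).1.toPFilter, (hR.box_clopen U.1 U.2).2⟩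
  dia U := ⟨(hR.dia_clopen U.1 U.2).1.toPFilter, (hR.dia_clopen U.1 U.2).2⟩
  box_top := Subtype.ext (SetLike.ext fun x => ⟨fun _ => trivial, fun _ _ _ => trivial⟩)
  dia_top := Subtype.ext (SetLike.ext fun x =>
    ⟨fun _ => trivial, fun _ => (hR.serial x).imp fun _ h => ⟨h, trivial⟩⟩)
  box_inf_box U V := Subtype.ext (SetLike.ext fun x =>
    ⟨fun h y hy => ⟨h.1 y hy, h.2 y hy⟩, fun h => ⟨fun y hy => (h y hy).1, fun y hy => (h y hy).2⟩⟩)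
  dia_sup_dia_le U V := by
    rintro x ⟨y, ⟨u, hu, huU⟩, z, ⟨v, hv, hvV⟩, hx⟩
    refine PFilter.mem_of_le hx (PFilter.inf_mem ?_ ?_)
    · exact ⟨u, hu, u, huU, ⊤, PFilter.top_mem, inf_le_left⟩
    · exact ⟨v, hv, ⊤, PFilter.top_mem, v, hvV, inf_le_right⟩
  dia_inf_box_le U V := by
    rintro x ⟨⟨y, hy, hyU⟩, h⟩
    exact ⟨y, hy, hyU, h y hy⟩

theorem IsModalLSpace.holds_clopenFilters (hR : IsModalLSpace R) {n : AxiomName}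
    (hn : n.Condition R) : @AxiomName.Holds (ClopenFilter X) hR.clopenFilters n := by
  cases n
  case T => exact fun U => ⟨fun x hx => hx x (hn x), fun x hx => ⟨x, hn x, hx⟩⟩
  case four =>
    exact fun U => ⟨fun x hx y hy z hz => hx z (hn x y z hy hz),
      fun x ⟨y, hy, z, hz, h⟩ => ⟨z, hn x y z hy hz, h⟩⟩
  case B =>
    exact fun U => ⟨fun x hx y hy => ⟨x, hn x y hy, hx⟩, fun x ⟨y, hy, h⟩ => h x (hn x y hy)⟩
  case five =>
    exact fun U => ⟨fun x ⟨y, hy, h⟩ z hz => ⟨y, hn x z y hz hy, h⟩,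
      fun x ⟨y, hy, h⟩ z hz => h z (hn x y z hy hz)⟩
  case dotTwo =>
    rintro U x ⟨y, hy, h⟩ z hz
    obtain ⟨t, ht, ht'⟩ := hn x y z hy hz
    exact ⟨t, ht', h t ht⟩

/-- A point is sent to the set of clopen filters containing it. Separation makes this an order
embedding, compactness makes it onto, and `rel_iff` says exactly that it preserves and reflects the
relations. -/
theorem IsModalLSpace.iso_dualRel (hR : IsModalLSpace R) :
    letI := hR.clopenFilters
    ModalLSpaceIso R (dualRel (ClopenFilter X)) := by
  let := hR.clopenFilters
  have := hR.isLSpace.compact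
  let f : X → PFilter (ClopenFilter X) := fun x =>
    (IsPFilter.of_def (F := {U : ClopenFilter X | x ∈ U.1}) ⟨⊤, trivial⟩
      (fun U hU V hV => ⟨U ⊓ V, ⟨hU, hV⟩, inf_le_left, inf_le_right⟩)
      fun {U V} h hx => h hx).toPFilter
  have hf : ∀ (x : X) (U : ClopenFilter X), U ∈ f x ↔ x ∈ U.1 := fun _ _ => Iff.rfl
  have hle : ∀ x y, f x ≤ f y ↔ x ≤ y := fun x y => by
    refine ⟨fun h => ?_, fun h U hU => PFilter.mem_of_le (F := U.1) h hU⟩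
    by_contra hxy
    obtain ⟨U, hU, hx, hy⟩ := hR.isLSpace.separation x y hxy
    exact hy (h (x := ⟨U, hU⟩) hx)
  have hinj : Function.Injective f := fun x y h =>
    le_antisymm ((hle x y).1 h.le) ((hle y x).1 h.ge)
  have hsurj : Function.Surjective f := fun F => by
    have hclosed : ∀ U : ClopenFilter X, IsClosed {x | U ∈ F ↔ x ∈ U.1} := fun U => by
      by_cases hU : U ∈ F <;> simp only [hU, true_iff, false_iff]
      exacts [U.2.isClosed, U.2.compl.isClosed]
    -- For finitely many conditions, let `W` be the meet of the members of `F` involved. Each `U ∉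
    -- F` omits some point of `W`; the meet of such points stays in `W` and, by upward closure,
    -- avoids each such `U`. For `U ∈ F` the choice `⊤` is a harmless default.
    obtain ⟨x, -, hx⟩ := (isCompact_univ (X := X)).inter_iInter_nonempty _ hclosed fun s => by
      classical
      let W := (s.filter (· ∈ F)).inf id
      have hW : W ∈ F := PFilter.finsetInf_mem F _ _ fun U hU => (Finset.mem_filter.1 hU).2
      have hex : ∀ U : ClopenFilter X, ∃ x ∈ W.1, U ∉ F → x ∉ U.1 := fun U => by
        by_cases hU : U ∈ F
        · exact ⟨⊤, PFilter.top_mem, fun h => (h hU).elim⟩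
        · obtain ⟨x, hx, hx'⟩ := SetLike.not_le_iff_exists.1 fun h : W.1 ≤ U.1 =>
            hU (PFilter.mem_of_le h hW)
          exact ⟨x, hx, fun _ => hx'⟩
      choose g hg hg' using hex
      refine ⟨s.inf g, trivial, ?_⟩
      simp only [mem_iInter]
      refine fun U hU => ⟨fun hUF => ?_, fun h => ?_⟩
      · have hWU : W ≤ U := Finset.inf_le (f := id) (Finset.mem_filter.2 ⟨hU, hUF⟩)
        exact hWU (PFilter.finsetInf_mem W.1 s g fun i _ => hg i)
      · by_contra hUF
        exact hg' U hUF (PFilter.mem_of_le (Finset.inf_le hU) h)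
    exact ⟨x, SetLike.ext fun U => (mem_iInter.1 hx U).symm⟩
  have hcont : Continuous f := continuous_generateFrom_iff.2 <| by
    rintro s ⟨U, rfl | rfl⟩
    · exact U.2.isOpen
    · exact U.2.compl.isOpen
  let e : X ≃o PFilter (ClopenFilter X) :=
    ⟨Equiv.ofBijective f ⟨hinj, hsurj⟩, fun {x y} => hle x y⟩
  -- The inverse is continuous because a continuous bijection from a compact space to a Hausdorff
  -- space is a homeomorphism.
  refine modalLSpaceIso_iff.2 ⟨e, hcont, (Continuous.homeoOfEquivCompactToT2 (f := e.toEquiv)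
    hcont).symm.continuous, fun x y => ?_⟩
  rw [hR.rel_iff]
  exact ⟨fun h U => h U.1 U.2, fun h U hU => h ⟨U, hU⟩⟩

end ClopenFilters

end WPML

open WPML
theorem mainTheorem5 {P : Type u} (p : P) (Γ : Set AxiomName) :
    (∀ (X : Type w) [SemilatticeInf X] [OrderTop X] [TopologicalSpace X] (R : X → X → Prop),
      (IsModalLSpace R ∧ Theta Γ R) ↔
        ∃ (A : Type w) (_ : ModalLattice A),
          InVariety (axiomPairs p Γ) A ∧ ModalLSpaceIso R (dualRel A)) ∧
    SoundAndComplete (axiomPairs p Γ) {F : ModalLFrame.{v} | Theta Γ F.rel} := by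
  refine ⟨fun X _ _ _ R => ⟨fun ⟨hR, hΓ⟩ => ?_, fun ⟨A, _, hA, hiso⟩ => ?_⟩,
    soundAndComplete_theta p Γ⟩
  · let := hR.clopenFilters
    exact ⟨ClopenFilter X, hR.clopenFilters, (inVariety_axiomPairs_iff p Γ _).2 fun n hn =>
      hR.holds_clopenFilters (hΓ n hn), hR.iso_dualRel⟩
  · obtain ⟨f, hf, hf', h⟩ := modalLSpaceIso_iff.1 hiso
    exact ⟨isModalLSpace_dualRel.of_orderIso f hf hf' h,
      (theta_dualRel ((inVariety_axiomPairs_iff p Γ A).1 hA)).of_equiv f.toEquiv h⟩
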